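/- Let $n\ge 1$ and let $A$ be an $n\times n$ complex matrix that is a strict contraction, i.e. its spectral norm satisfies $\|A\|<1$. For an $n\times n$ Hermitian matrix $X$ let $\lambda_1(X)\ge\cdots\ge\lambda_n(X)$ denote its eigenvalues, counted with multiplicity, and let $r_1\ge r_2\ge\cdots\ge r_n$ be the singular values of $A$. Then $1$ is not an eigenvalue of $A$ and $0\le r_n\le\cdots\le r_1<1$. Let $$M=(I-A^*)^{-1}(I-A^*A)(I-A)^{-1},$$ which is Hermitian, where $A^*$ is the conjugate transpose of $A$ and $I$ is the identity matrix. Then $$\lambda_j(M)\le \frac{1+r_j}{1-r_j}\qquad (j=1,\dots,n),$$ and for every $k\in\{1,\dots,n\}$ and all indices $1\le i_1<\cdots<i_k\le n$, $$\prod_{j=1}^k\lambda_{i_j}(M)\le\prod_{j=1}^k\frac{1+r_{i_j}}{1-r_{i_j}}\le\prod_{j=1}^k\frac{1+r_j}{1-r_j}$$ and $$\prod_{j=1}^k\lambda_{n-i_j+1}(M)\ge\prod_{j=1}^k\frac{1-r_{i_j}^2}{(1+r_j)^2}\ge\prod_{j=1}^k\frac{1-r_j}{1+r_j}.$$ -/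

import Mathlib

open scoped Matrix

/-- `A` is a strict contraction: its spectral norm, i.e. its operator norm as a linear map of
`ℂⁿ` with the Euclidean norm, is less than one. -/
def IsStrictContraction {n : ℕ} (A : Matrix (Fin n) (Fin n) ℂ) : Prop :=
  ‖Matrix.toEuclideanCLM (n := Fin n) (𝕜 := ℂ) A‖ < 1

/-- The singular values of `A` in non-increasing order, counted with multiplicity and indexed
from zero: `sigma A 0 ≥ sigma A 1 ≥ …`. -/
noncomputable def sigma {n : ℕ} (A : Matrix (Fin n) (Fin n) ℂ) (j : Fin n) : ℝ :=
  (Matrix.toEuclideanLin A).singularValues j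

/-- The eigenvalues of a Hermitian matrix in non-increasing order, counted with multiplicity and
indexed from zero. -/
noncomputable def sortedEigenvalues {n : ℕ} {X : Matrix (Fin n) (Fin n) ℂ}
    (hX : X.IsHermitian) (j : Fin n) : ℝ :=
  hX.eigenvalues₀ (Fin.cast (Fintype.card_fin n).symm j)

/-- The matrix `(I - A*)⁻¹ (I - A* A) (I - A)⁻¹`. -/
noncomputable def harnackMatrix {n : ℕ} (A : Matrix (Fin n) (Fin n) ℂ) :
    Matrix (Fin n) (Fin n) ℂ :=
  (1 - Aᴴ)⁻¹ * (1 - Aᴴ * A) * (1 - A)⁻¹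

theorem harnackMatrix_isHermitian {n : ℕ} (A : Matrix (Fin n) (Fin n) ℂ) :
    (harnackMatrix A).IsHermitian := by
  simp [Matrix.IsHermitian, harnackMatrix, Matrix.conjTranspose_mul,
    Matrix.conjTranspose_nonsing_inv, Matrix.mul_assoc]

/-! Substituting `x = (1 - A) y` turns the quadratic form of `harnackMatrix A` at `x` into `‖y‖² -
‖A y‖²`, while `‖x‖` lies between `‖y‖ - ‖A y‖` and `‖y‖ + ‖A y‖`. If `‖A y‖ ≤ r ‖y‖` with `r < 1`,
the Rayleigh quotient at `x` therefore lies between `(1 - r)/(1 + r)` and `(1 + r)/(1 - r)`. For `r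
= sigma A j` this holds for `y` in the span of the right singular vectors of index at least `j`. The
image of that span under the injective map `1 - A` has dimension `n - j`, so the two halves of
Courant–Fischer bound the eigenvalue at `j` from above and the one at `j.rev` from below. The
product inequalities then hold factor by factor. -/

open Module InnerProductSpace

namespace OrthonormalBasis

variable {𝕜 E : Type*} [RCLike 𝕜] [NormedAddCommGroup E] [InnerProductSpace 𝕜 E] {m : ℕ}

theorem repr_eq_zero_of_mem_span (b : OrthonormalBasis (Fin m) 𝕜 E) {S : Set (Fin m)} {v : E}
    (hv : v ∈ Submodule.span 𝕜 (b '' S)) {i : Fin m} (hi : i ∉ S) : b.repr v i = 0 := by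
  rw [← b.coe_toBasis, Module.Basis.mem_span_image] at hv
  by_contra h
  exact hi (hv (by simpa using h))

theorem norm_sq_eq_sum_repr (b : OrthonormalBasis (Fin m) 𝕜 E) (v : E) :
    ‖v‖ ^ 2 = ∑ i, ‖b.repr v i‖ ^ 2 := by
  rw [← b.repr.norm_map, EuclideanSpace.norm_sq_eq]

theorem finrank_span_image (b : OrthonormalBasis (Fin m) 𝕜 E) (S : Finset (Fin m)) :
    finrank 𝕜 (Submodule.span 𝕜 (b '' (S : Set (Fin m)))) = S.card := by
  rw [Set.image_eq_range]
  exact (finrank_span_eq_card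
    (b.orthonormal.linearIndependent.comp _ Subtype.val_injective)).trans (Fintype.card_coe S)

end OrthonormalBasis

theorem Submodule.exists_mem_mem_ne_zero {𝕜 E : Type*} [Field 𝕜] [AddCommGroup E] [Module 𝕜 E]
    [FiniteDimensional 𝕜 E] {V W : Submodule 𝕜 E}
    (h : finrank 𝕜 E < finrank 𝕜 V + finrank 𝕜 W) : ∃ v ∈ V, v ∈ W ∧ v ≠ 0 := by
  have h₁ := Submodule.finrank_sup_add_finrank_inf_eq V W
  have h₂ := (V ⊔ W).finrank_le
  have h₃ : V ⊓ W ≠ ⊥ := by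
    intro h₀
    rw [h₀, finrank_bot] at h₁
    omega
  obtain ⟨v, hv, hv₀⟩ := Submodule.exists_mem_ne_zero_of_ne_bot h₃
  exact ⟨v, hv.1, hv.2, hv₀⟩

/-! ### Rayleigh quotients and Courant–Fischer -/

namespace LinearMap.IsSymmetric

variable {𝕜 E : Type*} [RCLike 𝕜] [NormedAddCommGroup E] [InnerProductSpace 𝕜 E]
  [FiniteDimensional 𝕜 E] {T : E →ₗ[𝕜] E} {m : ℕ}

theorem re_inner_apply_eq_sum (hT : T.IsSymmetric) (hm : finrank 𝕜 E = m) (v : E) :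
    RCLike.re (inner 𝕜 v (T v)) =
      ∑ i, hT.eigenvalues hm i * ‖(hT.eigenvectorBasis hm).repr v i‖ ^ 2 := by
  rw [← (hT.eigenvectorBasis hm).repr.inner_map_map, PiLp.inner_apply, map_sum]
  refine Finset.sum_congr rfl fun i _ => ?_
  rw [eigenvectorBasis_apply_self_apply, RCLike.inner_apply, mul_assoc, RCLike.mul_conj,
    ← RCLike.ofReal_pow, ← RCLike.ofReal_mul, RCLike.ofReal_re]

theorem eigenvalue_mul_le_re_inner_of_mem_span (hT : T.IsSymmetric) (hm : finrank 𝕜 E = m)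
    (j : Fin m) {v : E} (hv : v ∈ Submodule.span 𝕜 (hT.eigenvectorBasis hm '' Set.Iic j)) :
    hT.eigenvalues hm j * ‖v‖ ^ 2 ≤ RCLike.re (inner 𝕜 v (T v)) := by
  rw [hT.re_inner_apply_eq_sum hm, OrthonormalBasis.norm_sq_eq_sum_repr (hT.eigenvectorBasis hm),
    Finset.mul_sum]
  refine Finset.sum_le_sum fun i _ => ?_
  by_cases hi : i ≤ j
  · exact mul_le_mul_of_nonneg_right (hT.eigenvalues_antitone hm hi) (sq_nonneg _)
  · simp [OrthonormalBasis.repr_eq_zero_of_mem_span _ hv (show i ∉ Set.Iic j from hi)]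

theorem re_inner_le_eigenvalue_mul_of_mem_span (hT : T.IsSymmetric) (hm : finrank 𝕜 E = m)
    (j : Fin m) {v : E} (hv : v ∈ Submodule.span 𝕜 (hT.eigenvectorBasis hm '' Set.Ici j)) :
    RCLike.re (inner 𝕜 v (T v)) ≤ hT.eigenvalues hm j * ‖v‖ ^ 2 := by
  rw [hT.re_inner_apply_eq_sum hm, OrthonormalBasis.norm_sq_eq_sum_repr (hT.eigenvectorBasis hm),
    Finset.mul_sum]
  refine Finset.sum_le_sum fun i _ => ?_
  by_cases hi : j ≤ i
  · exact mul_le_mul_of_nonneg_right (hT.eigenvalues_antitone hm hi) (sq_nonneg _)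
  · simp [OrthonormalBasis.repr_eq_zero_of_mem_span _ hv (show i ∉ Set.Ici j from hi)]

/-- The upper half of the Courant–Fischer principle. -/
theorem eigenvalues_le_of_forall_mem (hT : T.IsSymmetric) (hm : finrank 𝕜 E = m) (j : Fin m)
    (V : Submodule 𝕜 E) (hV : m ≤ finrank 𝕜 V + j) {t : ℝ}
    (ht : ∀ v ∈ V, RCLike.re (inner 𝕜 v (T v)) ≤ t * ‖v‖ ^ 2) : hT.eigenvalues hm j ≤ t := by
  have hW := OrthonormalBasis.finrank_span_image (hT.eigenvectorBasis hm) (Finset.Iic j)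
  rw [Finset.coe_Iic, Fin.card_Iic] at hW
  -- Zero-based indexing gives the top eigenspan dimension `j + 1`, so the two dimensions sum to
  -- more than `m`.
  obtain ⟨v, hv, hvW, hv₀⟩ := Submodule.exists_mem_mem_ne_zero (V := V) (by rw [hW]; omega)
  exact le_of_mul_le_mul_right
    ((hT.eigenvalue_mul_le_re_inner_of_mem_span hm j hvW).trans (ht v hv)) (by positivity)

/-- The lower half of the Courant–Fischer principle. -/
theorem le_eigenvalues_of_forall_mem (hT : T.IsSymmetric) (hm : finrank 𝕜 E = m) (j : Fin m)
    (V : Submodule 𝕜 E) (hV : (j : ℕ) < finrank 𝕜 V) {t : ℝ}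
    (ht : ∀ v ∈ V, t * ‖v‖ ^ 2 ≤ RCLike.re (inner 𝕜 v (T v))) : t ≤ hT.eigenvalues hm j := by
  have hW := OrthonormalBasis.finrank_span_image (hT.eigenvectorBasis hm) (Finset.Ici j)
  rw [Finset.coe_Ici, Fin.card_Ici] at hW
  obtain ⟨v, hv, hvW, hv₀⟩ := Submodule.exists_mem_mem_ne_zero (V := V) (by rw [hW]; omega)
  exact le_of_mul_le_mul_right
    ((ht v hv).trans (hT.re_inner_le_eigenvalue_mul_of_mem_span hm j hvW)) (by positivity)

end LinearMap.IsSymmetric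

/-! ### Singular values -/

namespace LinearMap

variable {𝕜 E F : Type*} [RCLike 𝕜] [NormedAddCommGroup E] [InnerProductSpace 𝕜 E]
  [FiniteDimensional 𝕜 E] [NormedAddCommGroup F] [InnerProductSpace 𝕜 F] [FiniteDimensional 𝕜 F]
  (T : E →ₗ[𝕜] F)

theorem re_inner_adjoint_comp_self (v : E) :
    RCLike.re (inner 𝕜 v ((adjoint T ∘ₗ T) v)) = ‖T v‖ ^ 2 := by
  rw [comp_apply, adjoint_inner_right, inner_self_eq_norm_sq]

theorem exists_finrank_norm_apply_le_singularValues {j : ℕ} (hj : j < finrank 𝕜 E) :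
    ∃ V : Submodule 𝕜 E, finrank 𝕜 V = finrank 𝕜 E - j ∧
      ∀ v ∈ V, ‖T v‖ ≤ T.singularValues j * ‖v‖ := by
  have hT := T.isSymmetric_adjoint_comp_self
  refine ⟨Submodule.span 𝕜 (hT.eigenvectorBasis rfl '' Set.Ici ⟨j, hj⟩), ?_, fun v hv => ?_⟩
  · rw [← Finset.coe_Ici, OrthonormalBasis.finrank_span_image, Fin.card_Ici]
  · have h := hT.re_inner_le_eigenvalue_mul_of_mem_span rfl _ hv
    rw [T.re_inner_adjoint_comp_self, ← T.sq_singularValues_of_lt rfl hj, ← mul_pow] at h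
    exact le_of_sq_le_sq h (mul_nonneg (T.singularValues_nonneg j) (norm_nonneg v))

theorem exists_norm_apply_eq_singularValues {j : ℕ} (hj : j < finrank 𝕜 E) :
    ∃ v : E, ‖v‖ = 1 ∧ ‖T v‖ = T.singularValues j := by
  have hT := T.isSymmetric_adjoint_comp_self
  refine ⟨hT.eigenvectorBasis rfl ⟨j, hj⟩, OrthonormalBasis.norm_eq_one _ _, ?_⟩
  rw [← sq_eq_sq₀ (norm_nonneg _) (T.singularValues_nonneg j), ← T.re_inner_adjoint_comp_self,
    hT.apply_eigenvectorBasis, T.sq_singularValues_of_lt rfl hj, inner_smul_right]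
  simp

end LinearMap

/-! ### Eigenvalue bounds for `harnackMatrix` -/

section Harnack

variable {n : ℕ} {A : Matrix (Fin n) (Fin n) ℂ}

theorem IsStrictContraction.isUnit_one_sub (hA : IsStrictContraction A) : IsUnit (1 - A) := by
  have h := isUnit_one_sub_of_norm_lt_one hA
  rwa [← map_one (Matrix.toEuclideanCLM (n := Fin n) (𝕜 := ℂ)), ← map_sub,
    MulEquiv.isUnit_map] at h

theorem sigma_nonneg (A : Matrix (Fin n) (Fin n) ℂ) (j : Fin n) : 0 ≤ sigma A j :=
  LinearMap.singularValues_nonneg _ _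

theorem sigma_antitone (A : Matrix (Fin n) (Fin n) ℂ) : Antitone (sigma A) :=
  fun _ _ h => LinearMap.singularValues_antitone _ h

theorem IsStrictContraction.sigma_lt_one (hA : IsStrictContraction A) (j : Fin n) :
    sigma A j < 1 := by
  obtain ⟨v, hv, h⟩ := (Matrix.toEuclideanLin A).exists_norm_apply_eq_singularValues
    (j := j) (by simp)
  have h₁ := (Matrix.toEuclideanCLM (n := Fin n) (𝕜 := ℂ) A).le_opNorm v
  rw [hv, mul_one] at h₁
  exact (h.symm.le.trans h₁).trans_lt hA

/-- Congruence by `1 - A` cancels both inverses and leaves `1 - Aᴴ * A`. -/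
theorem re_inner_harnackMatrix (hA : IsUnit (1 - A)) (y : EuclideanSpace ℂ (Fin n)) :
    RCLike.re (inner ℂ (Matrix.toEuclideanLin (1 - A) y)
      (Matrix.toEuclideanLin (harnackMatrix A) (Matrix.toEuclideanLin (1 - A) y))) =
      ‖y‖ ^ 2 - ‖Matrix.toEuclideanLin A y‖ ^ 2 := by
  have hdet : IsUnit (1 - A).det := (Matrix.isUnit_iff_isUnit_det _).1 hA
  have hM : (1 - A)ᴴ * harnackMatrix A * (1 - A) = 1 - Aᴴ * A := by
    have hdet' : IsUnit (1 - Aᴴ).det := by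
      rw [← Matrix.isUnit_iff_isUnit_det]
      simpa [Matrix.star_eq_conjTranspose] using hA.star
    rw [harnackMatrix, Matrix.mul_assoc, Matrix.nonsing_inv_mul_cancel_right _ _ hdet, Matrix.conjTranspose_sub,
      Matrix.conjTranspose_one, Matrix.mul_nonsing_inv_cancel_left _ _ hdet']
  have hmul (B C : Matrix (Fin n) (Fin n) ℂ) (x : EuclideanSpace ℂ (Fin n)) :
      Matrix.toEuclideanLin B (Matrix.toEuclideanLin C x) = Matrix.toEuclideanLin (B * C) x := by
    simp [Matrix.toLpLin_apply]
  rw [← LinearMap.adjoint_inner_right, ← Matrix.toEuclideanLin_conjTranspose_eq_adjoint, hmul, hmul,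
    hM, map_sub, LinearMap.sub_apply, inner_sub_right, map_sub, ← hmul,
    Matrix.toEuclideanLin_conjTranspose_eq_adjoint, LinearMap.adjoint_inner_right,
    inner_self_eq_norm_sq]
  congr 1
  rw [Matrix.toLpLin_one]
  exact inner_self_eq_norm_sq y

theorem exists_finrank_harnackMatrix_bounds (hA : IsStrictContraction A) (j : Fin n) :
    ∃ V : Submodule ℂ (EuclideanSpace ℂ (Fin n)), finrank ℂ V = n - j ∧ ∀ x ∈ V,
      (1 - sigma A j) / (1 + sigma A j) * ‖x‖ ^ 2 ≤
        RCLike.re (inner ℂ x (Matrix.toEuclideanLin (harnackMatrix A) x)) ∧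
      RCLike.re (inner ℂ x (Matrix.toEuclideanLin (harnackMatrix A) x)) ≤
        (1 + sigma A j) / (1 - sigma A j) * ‖x‖ ^ 2 := by
  obtain ⟨V, hV, h⟩ := (Matrix.toEuclideanLin A).exists_finrank_norm_apply_le_singularValues
    (j := j) (by simp)
  rw [finrank_euclideanSpace_fin] at hV
  have hU := hA.isUnit_one_sub
  have hinj : Function.Injective (Matrix.toEuclideanLin (1 - A)) := by
    intro x y hxy
    simp only [Matrix.toLpLin_apply] at hxy
    exact WithLp.ofLp_injective 2
      (Matrix.mulVec_injective_of_isUnit hU (WithLp.toLp_injective 2 hxy))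
  refine ⟨V.map (Matrix.toEuclideanLin (1 - A)), ?_, ?_⟩
  · rw [← (Submodule.equivMapOfInjective _ hinj V).finrank_eq, hV]
  rintro _ ⟨y, hy, rfl⟩
  rw [re_inner_harnackMatrix hU]
  have hsub : Matrix.toEuclideanLin (1 - A) y = y - Matrix.toEuclideanLin A y := by
    simp
  rw [hsub]
  have h₁ : ‖Matrix.toEuclideanLin A y‖ ≤ sigma A j * ‖y‖ := h y hy
  have h₂ := norm_sub_le y (Matrix.toEuclideanLin A y)
  have h₃ := norm_sub_norm_le y (Matrix.toEuclideanLin A y)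
  have hr₀ := sigma_nonneg A j
  have hr₁ := hA.sigma_lt_one j
  generalize sigma A j = r at *
  generalize ‖y - Matrix.toEuclideanLin A y‖ = c at *
  have ha := norm_nonneg y
  have hb := norm_nonneg (Matrix.toEuclideanLin A y)
  generalize ‖Matrix.toEuclideanLin A y‖ = b at *
  generalize ‖y‖ = a at *
  have hba : b ≤ a := h₁.trans (mul_le_of_le_one_left ha hr₁.le)
  have hc : 0 ≤ c := by linarith
  -- The difference of the two sides is `2 (r a - b)`; both bounds follow on multiplying by `a + b`
  -- or `a - b`.
  have hcross : (1 - r) * (a + b) ≤ (1 + r) * (a - b) := by linarith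
  constructor
  · rw [div_mul_eq_mul_div, div_le_iff₀ (by linarith)]
    calc (1 - r) * c ^ 2 ≤ (1 - r) * (a + b) ^ 2 := by gcongr
      _ = (1 - r) * (a + b) * (a + b) := by ring
      _ ≤ (1 + r) * (a - b) * (a + b) := by gcongr
      _ = (a ^ 2 - b ^ 2) * (1 + r) := by ring
  · rw [div_mul_eq_mul_div, le_div_iff₀ (by linarith)]
    calc (a ^ 2 - b ^ 2) * (1 - r) = (1 - r) * (a + b) * (a - b) := by ring
      _ ≤ (1 + r) * (a - b) * (a - b) := by gcongr
      _ = (1 + r) * (a - b) ^ 2 := by ring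
      _ ≤ (1 + r) * c ^ 2 := by gcongr

theorem sortedEigenvalues_harnackMatrix_le (hA : IsStrictContraction A) (j : Fin n) :
    sortedEigenvalues (harnackMatrix_isHermitian A) j ≤ (1 + sigma A j) / (1 - sigma A j) := by
  obtain ⟨V, hV, h⟩ := exists_finrank_harnackMatrix_bounds hA j
  exact LinearMap.IsSymmetric.eigenvalues_le_of_forall_mem _ _ _ V
    (by rw [hV, Fin.val_cast]; simp only [Fintype.card_fin]; omega) fun x hx => (h x hx).2

theorem le_sortedEigenvalues_harnackMatrix_rev (hA : IsStrictContraction A) (j : Fin n) :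
    (1 - sigma A j) / (1 + sigma A j) ≤
      sortedEigenvalues (harnackMatrix_isHermitian A) j.rev := by
  obtain ⟨V, hV, h⟩ := exists_finrank_harnackMatrix_bounds hA j
  exact LinearMap.IsSymmetric.le_eigenvalues_of_forall_mem _ _ _ V
    -- The index `n - 1 - j` is just below the dimension `n - j`.
    (by rw [hV, Fin.val_cast, Fin.val_rev]; omega) fun x hx => (h x hx).1

/-- Needed to multiply the upper bounds termwise. -/
theorem sortedEigenvalues_harnackMatrix_nonneg (hA : IsStrictContraction A) (j : Fin n) :
    0 ≤ sortedEigenvalues (harnackMatrix_isHermitian A) j := by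
  have h := le_sortedEigenvalues_harnackMatrix_rev hA j.rev
  rw [Fin.rev_rev] at h
  exact (div_nonneg (by linarith [hA.sigma_lt_one j.rev])
    (by linarith [sigma_nonneg A j.rev])).trans h

end Harnack

/-! ### Products over increasing indices -/

theorem Fin.castLE_le_of_strictMono {k n : ℕ} (hk : k ≤ n) {i : Fin k → Fin n} (hi : StrictMono i)
    (j : Fin k) : Fin.castLE hk j ≤ i j := by
  obtain ⟨j, hj⟩ := j
  rw [Fin.le_def, Fin.val_castLE]
  induction j with
  | zero => exact Nat.zero_le _
  | succ j ih =>
    exact (ih (by omega)).trans_lt (hi (Fin.mk_lt_mk.2 j.lt_succ_self))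

theorem theorem2p2 {n : ℕ} (A : Matrix (Fin n) (Fin n) ℂ) (hA : IsStrictContraction A) :
    (1 : ℂ) ∉ spectrum ℂ A ∧
    (Antitone (sigma A) ∧ ∀ j : Fin n, 0 ≤ sigma A j ∧ sigma A j < 1) ∧
    (∀ j : Fin n,
      sortedEigenvalues (harnackMatrix_isHermitian A) j ≤ (1 + sigma A j) / (1 - sigma A j)) ∧
    (∀ (k : ℕ) (hk : k ≤ n) (i : Fin k → Fin n), StrictMono i →
      (∏ j : Fin k, sortedEigenvalues (harnackMatrix_isHermitian A) (i j)
          ≤ ∏ j : Fin k, (1 + sigma A (i j)) / (1 - sigma A (i j)) ∧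
        ∏ j : Fin k, (1 + sigma A (i j)) / (1 - sigma A (i j))
          ≤ ∏ j : Fin k, (1 + sigma A (Fin.castLE hk j)) / (1 - sigma A (Fin.castLE hk j))) ∧
      (∏ j : Fin k, (1 - sigma A (i j) ^ 2) / (1 + sigma A (Fin.castLE hk j)) ^ 2
          ≤ ∏ j : Fin k, sortedEigenvalues (harnackMatrix_isHermitian A) (Fin.rev (i j)) ∧
        ∏ j : Fin k, (1 - sigma A (Fin.castLE hk j)) / (1 + sigma A (Fin.castLE hk j))
          ≤ ∏ j : Fin k, (1 - sigma A (i j) ^ 2) / (1 + sigma A (Fin.castLE hk j)) ^ 2)) := by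
  refine ⟨?_, ⟨sigma_antitone A, fun j => ⟨sigma_nonneg A j, hA.sigma_lt_one j⟩⟩,
    sortedEigenvalues_harnackMatrix_le hA, fun k hk i hi => ?_⟩
  · rw [spectrum.mem_iff, not_not, map_one]
    exact hA.isUnit_one_sub
  have hr (j : Fin k) : sigma A (i j) ≤ sigma A (Fin.castLE hk j) :=
    sigma_antitone A (Fin.castLE_le_of_strictMono hk hi j)
  have h₀ := sigma_nonneg A
  have h₁ (j : Fin n) : 0 < 1 - sigma A j := sub_pos.2 (hA.sigma_lt_one j)
  have hsq (j : Fin n) : 1 - sigma A j ^ 2 = (1 - sigma A j) * (1 + sigma A j) := by ring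
  refine ⟨⟨?_, ?_⟩, ?_, ?_⟩
  · exact Finset.prod_le_prod (fun j _ => sortedEigenvalues_harnackMatrix_nonneg hA _)
      fun j _ => sortedEigenvalues_harnackMatrix_le hA _
  · refine Finset.prod_le_prod (fun j _ => ?_) fun j _ => ?_
    · exact div_nonneg (by linarith [h₀ (i j)]) (h₁ _).le
    · exact div_le_div₀ (by linarith [h₀ (Fin.castLE hk j)]) (by linarith [hr j]) (h₁ _)
        (by linarith [hr j])
  · refine Finset.prod_le_prod (fun j _ => ?_) fun j _ =>
      le_trans ?_ (le_sortedEigenvalues_harnackMatrix_rev hA (i j))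
    · rw [hsq]
      exact div_nonneg (mul_nonneg (h₁ _).le (by linarith [h₀ (i j)])) (sq_nonneg _)
    · have h₂ : 0 < 1 + sigma A (i j) := by linarith [h₀ (i j)]
      -- By `hr`, passing to `i j` only shrinks the denominator; the quotient then reduces to the
      -- one-eigenvalue bound.
      calc (1 - sigma A (i j) ^ 2) / (1 + sigma A (Fin.castLE hk j)) ^ 2
          ≤ (1 - sigma A (i j) ^ 2) / (1 + sigma A (i j)) ^ 2 := by
            have : 0 ≤ 1 - sigma A (i j) ^ 2 := by
              rw [hsq]
              exact mul_nonneg (h₁ _).le h₂.le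
            gcongr
            exact hr j
        _ = (1 - sigma A (i j)) / (1 + sigma A (i j)) := by
            rw [hsq]
            field_simp
  · refine Finset.prod_le_prod (fun j _ => ?_) fun j _ => ?_
    · exact div_nonneg (h₁ _).le (by linarith [h₀ (Fin.castLE hk j)])
    · have h₂ : 0 < 1 + sigma A (Fin.castLE hk j) := by linarith [h₀ (Fin.castLE hk j)]
      calc (1 - sigma A (Fin.castLE hk j)) / (1 + sigma A (Fin.castLE hk j))
          = (1 - sigma A (Fin.castLE hk j) ^ 2) / (1 + sigma A (Fin.castLE hk j)) ^ 2 := by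
            rw [hsq]
            field_simp
        _ ≤ (1 - sigma A (i j) ^ 2) / (1 + sigma A (Fin.castLE hk j)) ^ 2 := by
            have := h₀ (i j)
            gcongr
            exact hr j
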